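/- All graphs are finite, simple and undirected. Counting first-order logic $\mathsf{C}$ is built from the atomic formulae $x_i = x_j$ and $E x_i x_j$ with the connectives $\neg, \land, \lor, \rightarrow$ and the quantifiers $\forall x_i$, $\exists x_i$ and $\exists^{\geq t} x_i$ ($t \in \mathbb{N}$), where $\exists^{\geq t} x\, \varphi$ says that at least $t$ distinct vertices satisfy $\varphi$. The quantifier rank of a formula is the maximum nesting depth of its quantifiers (each quantifier counting $1$). For $k, q \geq 1$ let $\mathsf{C}^k_q$ be the set of all $\mathsf{C}$-formulae of quantifier rank at most $q$ in which at most $k$ distinct variables occur. Two graphs are $\mathsf{C}^k_q$-equivalent if they satisfy the same sentences of $\mathsf{C}^k_q$. A rooted forest on a vertex set is described by its ancestor order $\preceq$, a partial order in which the elements below any given vertex are pairwise comparable; its height is the maximum number of vertices in a $\preceq$-chain. A $k$-pebble forest cover of a graph $F$ consists of a rooted forest on $V(F)$ and a function $p \colon V(F) \to \{1, \dots, k\}$ such that, for every edge $uv \in E(F)$, (i) $u \preceq v$ or $v \preceq u$, and (ii) if $u \prec v$, then $p(u) \neq p(w)$ for every $w \in V(F)$ with $u \prec w \preceq v$. Its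 depth is the height of the forest. Let $\mathcal{T}^k_q$ be the class of all graphs that admit a $k$-pebble forest cover of depth at most $q$. Two graphs $G$ and $H$ are homomorphism indistinguishable over a class $\mathcal{F}$ of graphs if, for every $F \in \mathcal{F}$, the number of homomorphisms from $F$ to $G$ equals the number of homomorphisms from $F$ to $H$. **Theorem.** Let $k, q \geq 1$. Two graphs $G$ and $H$ are $\mathsf{C}^k_q$-equivalent if and only if they are homomorphism indistinguishable over $\mathcal{T}^k_q$. -/

import Mathlib

universe u v

namespace CountingLogic

/-! ### Counting first-order logic on graphs -/

/-- Formulae of counting first-order logic `C` in the language of graphs. Variables are indexed by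
natural numbers. -/
inductive Formula : Type
  | eq (i j : ℕ) : Formula
  | adj (i j : ℕ) : Formula
  | neg (φ : Formula) : Formula
  | and (φ ψ : Formula) : Formula
  | or (φ ψ : Formula) : Formula
  | imp (φ ψ : Formula) : Formula
  | all (i : ℕ) (φ : Formula) : Formula
  | ex (i : ℕ) (φ : Formula) : Formula
  /-- the counting quantifier `∃^{≥ t} x_i` -/
  | exGe (t : ℕ) (i : ℕ) (φ : Formula) : Formula

namespace Formula

/-- The set of all variables occurring in a formula: free, bound, or next to a quantifier. -/
def vars : Formula → Finset ℕ
  | eq i j => {i, j}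
  | adj i j => {i, j}
  | neg φ => φ.vars
  | and φ ψ => φ.vars ∪ ψ.vars
  | or φ ψ => φ.vars ∪ ψ.vars
  | imp φ ψ => φ.vars ∪ ψ.vars
  | all i φ => insert i φ.vars
  | ex i φ => insert i φ.vars
  | exGe _ i φ => insert i φ.vars

/-- The set of free variables of a formula. -/
def free : Formula → Finset ℕ
  | eq i j => {i, j}
  | adj i j => {i, j}
  | neg φ => φ.free
  | and φ ψ => φ.free ∪ ψ.free
  | or φ ψ => φ.free ∪ ψ.free
  | imp φ ψ => φ.free ∪ ψ.free
  | all i φ => φ.free.erase i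
  | ex i φ => φ.free.erase i
  | exGe _ i φ => φ.free.erase i

/-- The quantifier rank of a formula. -/
def qr : Formula → ℕ
  | eq _ _ => 0
  | adj _ _ => 0
  | neg φ => φ.qr
  | and φ ψ => max φ.qr ψ.qr
  | or φ ψ => max φ.qr ψ.qr
  | imp φ ψ => max φ.qr ψ.qr
  | all _ φ => 1 + φ.qr
  | ex _ φ => 1 + φ.qr
  | exGe _ _ φ => 1 + φ.qr

/-- A sentence is a formula without free variables. -/
def IsSentence (φ : Formula) : Prop := φ.free = ∅

/-- `φ.Holds G ν` means that `G` satisfies `φ` when each variable `x_i` is interpreted by the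
vertex `ν i`. The interpretation `ν` is partial; it is meant to be defined at least on the free
variables of `φ`. -/
def Holds {V : Type u} (G : SimpleGraph V) : Formula → (ℕ → Option V) → Prop
  | eq i j, ν => ∃ a, ν i = some a ∧ ν j = some a
  | adj i j, ν => ∃ a b, ν i = some a ∧ ν j = some b ∧ G.Adj a b
  | neg φ, ν => ¬ φ.Holds G ν
  | and φ ψ, ν => φ.Holds G ν ∧ ψ.Holds G ν
  | or φ ψ, ν => φ.Holds G ν ∨ ψ.Holds G ν
  | imp φ ψ, ν => φ.Holds G ν → ψ.Holds G ν
  | all i φ, ν => ∀ a : V, φ.Holds G (Function.update ν i (some a))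
  | ex i φ, ν => ∃ a : V, φ.Holds G (Function.update ν i (some a))
  | exGe t i φ, ν => ∃ s : Finset V, s.card = t ∧
      ∀ a ∈ s, φ.Holds G (Function.update ν i (some a))

/-- Satisfaction of a sentence in a graph: no variable is interpreted from outside. -/
def Models {V : Type u} (G : SimpleGraph V) (φ : Formula) : Prop :=
  φ.Holds G (fun _ => none)

end Formula

/-- The `k`-variable fragment of `C`: all formulae in which at most `k` distinct variables occur. -/
def varFragment (k : ℕ) : Set Formula := {φ | φ.vars.card ≤ k}

/-- The quantifier-rank-`q` fragment of `C`. -/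
def rankFragment (q : ℕ) : Set Formula := {φ | φ.qr ≤ q}

/-- The `k`-variable quantifier-rank-`q` fragment of `C`. -/
def fragment (k q : ℕ) : Set Formula := varFragment k ∩ rankFragment q

/-- Two graphs are equivalent for a set `L` of formulae if they satisfy the same sentences
in `L`. -/
def Equivalent (L : Set Formula) {V : Type u} {W : Type v}
    (G : SimpleGraph V) (H : SimpleGraph W) : Prop :=
  ∀ φ ∈ L, φ.IsSentence → (φ.Models G ↔ φ.Models H)

/-! ### Pebble forest covers -/

/-- A rooted forest with vertex set `V`, given by its ancestor order: `le u v` means that `u` lies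
on the path from a root to `v`. -/
structure RootedForest (V : Type u) where
  le : V → V → Prop
  le_refl : ∀ u, le u u
  le_trans : ∀ u v w, le u v → le v w → le u w
  le_antisymm : ∀ u v, le u v → le v u → u = v
  comparable_below : ∀ u v w, le u w → le v w → le u v ∨ le v u

namespace RootedForest

/-- The strict ancestor order. -/
def lt {V : Type u} (T : RootedForest V) (x y : V) : Prop := T.le x y ∧ x ≠ y

/-- The height of a rooted forest: the largest number of vertices of a chain. -/
noncomputable def height {V : Type u} (T : RootedForest V) : ℕ∞ :=
  ⨆ (s : Finset V) (_ : IsChain T.le (s : Set V)), (s.card : ℕ∞)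

end RootedForest

/-- A `k`-pebble forest cover of a graph `F`. -/
structure PebbleForestCover (k : ℕ) {V : Type u} (F : SimpleGraph V) where
  forest : RootedForest V
  pebble : V → Fin k
  adj_comparable : ∀ x y, F.Adj x y → forest.le x y ∨ forest.le y x
  pebble_ne : ∀ x y, F.Adj x y → forest.lt x y →
    ∀ w, forest.lt x w → forest.le w y → pebble x ≠ pebble w

/-- Classes of finite graphs. The vertex sets are taken from `Type`, which contains every finite
graph up to isomorphism. -/
def GraphClass : Type 1 := ∀ (U : Type) [Finite U], SimpleGraph U → Prop

/-- The class of finite graphs admitting a `k`-pebble forest cover of depth (at most) `q`. -/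
def pebbleForestClass (k q : ℕ) : GraphClass :=
  fun _ _ F => ∃ C : PebbleForestCover k F, C.forest.height ≤ (q : ℕ∞)

/-! ### Homomorphism indistinguishability -/

/-- The number of homomorphisms from `F` to `G`. -/
noncomputable def homCount {U : Type u} {V : Type v} (F : SimpleGraph U) (G : SimpleGraph V) : ℕ :=
  Nat.card (F →g G)

/-- `G` and `H` are homomorphism indistinguishable over a class of finite graphs. -/
def HomIndistinguishable (𝓕 : GraphClass) {V : Type u} {W : Type v}
    (G : SimpleGraph V) (H : SimpleGraph W) : Prop :=
  ∀ (U : Type) [Finite U] (F : SimpleGraph U), 𝓕 U F → homCount F G = homCount F H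

end CountingLogic

/-! Both relations are compared with the `q`-round bijective pebble game `PebbleEquiv`.

Logic and game: Duplicator's bijection carries witnesses of every quantifier, counting ones included
(`PebbleEquiv.holds_iff`). Conversely, counting quantifiers show that each formula of smaller rank
has equally many solutions in both graphs, and Duplicator needs one bijection preserving all these
formulae at once (`pebbleEquiv_of_holds_iff`).

From game to counts: a homomorphism from a covered graph is built from the roots upwards, each
vertex moving its pebble onto its image. Branches multiply, a root gives a sum over its images, and
Duplicator's bijection matches the summands (`PebbleEquiv.extCount_eq`).

From counts to game: products and sums over a pebbled vertex generate the terms `HomTerm`. A term of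
depth at most `q`, evaluated with no pebble placed, is either zero in every graph or the
homomorphism count of a graph in the class (`HomIndistinguishable.val_eq`). Equal values yield
Duplicator's bijections (`pebbleEquiv_of_val_eq`).

Both constructions of bijections rest on `exists_equiv_of_sum_eq`: products of test functions
interpolate the indicator of a fibre up to a nonzero factor, so corresponding fibres are equally
large. -/

namespace CountingLogic

/-! ### Matching finite families by test functions -/

/-- If two finite families of points have equal sums for every function of a multiplicatively
closed system of functions, then they can be matched so that all functions agree. -/
theorem exists_equiv_of_sum_eq {X : Type u} {Y : Type v} [Fintype X] [Fintype Y] {T : Type*}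
    (f : T → X → ℤ) (g : T → Y → ℤ)
    (one : ∃ t, (∀ x, f t x = 1) ∧ ∀ y, g t y = 1)
    (mul : ∀ s t, ∃ r, (∀ x, f r x = f s x * f t x) ∧ ∀ y, g r y = g s y * g t y)
    (sum : ∀ t, ∑ x, f t x = ∑ y, g t y) :
    ∃ β : X ≃ Y, ∀ t x, f t x = g t (β x) := by
  classical
  let F : X ⊕ Y → T → ℤ := Sum.elim (fun x t => f t x) (fun y t => g t y)
  have key (z : X ⊕ Y) (S : Finset (X ⊕ Y)) (hS : ∀ w ∈ S, F w ≠ F z) :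
      ∃ h : (T → ℤ) → ℤ, h (F z) ≠ 0 ∧ (∀ w ∈ S, h (F w) = 0) ∧
        ∀ t, ∑ x, h (F (.inl x)) * f t x = ∑ y, h (F (.inr y)) * g t y := by
    induction S using Finset.induction_on with
    | empty => exact ⟨fun _ => 1, by simp, by simp, by simpa using sum⟩
    | insert w S _ ih =>
      obtain ⟨h, h1, h2, h3⟩ := ih fun v hv => hS v (Finset.mem_insert_of_mem hv)
      obtain ⟨s, hs⟩ := Function.ne_iff.1 (hS w (Finset.mem_insert_self _ _))
      -- Lagrange interpolation without denominators: the new factor vanishes at `w`, but not at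
      -- `z`, because `s` separates the two. Closure under products keeps the weighted sums equal.
      refine ⟨fun c => h c * (c s - F w s), mul_ne_zero h1 (sub_ne_zero.2 hs.symm), ?_, fun t => ?_⟩
      · intro v hv
        rcases Finset.mem_insert.1 hv with rfl | hv
        · simp
        · simp [h2 v hv]
      · obtain ⟨r, hr, hr'⟩ := mul s t
        have e1 (x : X) : h (F (.inl x)) * (F (.inl x) s - F w s) * f t x =
            h (F (.inl x)) * f r x - F w s * (h (F (.inl x)) * f t x) := by
          rw [hr]; simp only [F, Sum.elim_inl]; ring
        have e2 (y : Y) : h (F (.inr y)) * (F (.inr y) s - F w s) * g t y =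
            h (F (.inr y)) * g r y - F w s * (h (F (.inr y)) * g t y) := by
          rw [hr']; simp only [F, Sum.elim_inr]; ring
        simp only [e1, e2, Finset.sum_sub_distrib, ← Finset.mul_sum, h3]
  have card (c : T → ℤ) :
      Fintype.card {x // F (.inl x) = c} = Fintype.card {y // F (.inr y) = c} := by
    by_cases hc : ∃ z, F z = c
    · obtain ⟨z, rfl⟩ := hc
      -- Taking for `S` all points with another value makes `h` a nonzero multiple of the indicator
      -- of the fibre; the constant test function then compares the fibre sizes.
      obtain ⟨h, h1, h2, h3⟩ := key z {w | F w ≠ F z} (by simp)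
      obtain ⟨t, ht, ht'⟩ := one
      have h4 (w) : h (F w) = if F w = F z then h (F z) else 0 := by
        split_ifs with hw
        · rw [hw]
        · exact h2 w (by simpa using hw)
      have h5 := h3 t
      simp only [ht, ht', mul_one, h4 (.inl _), h4 (.inr _), ← Finset.sum_filter,
        Finset.sum_const, nsmul_eq_mul] at h5
      rw [Fintype.card_subtype, Fintype.card_subtype]
      exact_mod_cast mul_right_cancel₀ h1 h5
    · rw [Fintype.card_eq_zero_iff.2 ⟨fun x => hc ⟨_, x.2⟩⟩,
        Fintype.card_eq_zero_iff.2 ⟨fun x => hc ⟨_, x.2⟩⟩]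
  let e (c : T → ℤ) := Fintype.equivOfCardEq (card c)
  refine ⟨(Equiv.sigmaFiberEquiv fun x => F (.inl x)).symm.trans
    ((Equiv.sigmaCongrRight e).trans (Equiv.sigmaFiberEquiv fun y => F (.inr y))), ?_⟩
  exact fun t x => (congrFun (e (F (.inl x)) ⟨x, rfl⟩).2 t).symm

/-! ### The bijective pebble game -/

section Games

variable {ι : Type*} {V : Type u} {W : Type v}

/-- Adjacency of two partially defined vertices. -/
def OptAdj (G : SimpleGraph V) (x y : Option V) : Prop :=
  ∃ a b, x = some a ∧ y = some b ∧ G.Adj a b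

/-- Equality of two partially defined vertices. -/
def OptEq (x y : Option V) : Prop := ∃ a, x = some a ∧ y = some a

theorem optAdj_some {G : SimpleGraph V} {a b : V} : OptAdj G (some a) (some b) ↔ G.Adj a b := by
  simp [OptAdj]

theorem optAdj_symm {G : SimpleGraph V} {x y : Option V} (h : OptAdj G x y) : OptAdj G y x := by
  obtain ⟨a, b, ha, hb, hab⟩ := h
  exact ⟨b, a, hb, ha, hab.symm⟩

/-- Two positions of the pebble game have the same atomic type. -/
def AtomicEquiv (G : SimpleGraph V) (H : SimpleGraph W) (ν : ι → Option V) (μ : ι → Option W) :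
    Prop :=
  ∀ i j, (OptEq (ν i) (ν j) ↔ OptEq (μ i) (μ j)) ∧ (OptAdj G (ν i) (ν j) ↔ OptAdj H (μ i) (μ j))

/-- Duplicator wins the `q`-round bijective pebble game with pebbles `ι` from the given position. -/
def PebbleEquiv [DecidableEq ι] (G : SimpleGraph V) (H : SimpleGraph W) :
    ℕ → (ι → Option V) → (ι → Option W) → Prop
  | 0, ν, μ => AtomicEquiv G H ν μ
  | q + 1, ν, μ => AtomicEquiv G H ν μ ∧ ∀ i, ∃ β : V ≃ W, ∀ a,
      PebbleEquiv G H q (Function.update ν i (some a)) (Function.update μ i (some (β a)))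

theorem PebbleEquiv.atomic [DecidableEq ι] {G : SimpleGraph V} {H : SimpleGraph W} {q : ℕ}
    {ν : ι → Option V} {μ : ι → Option W} (h : PebbleEquiv G H q ν μ) : AtomicEquiv G H ν μ := by
  cases q with
  | zero => exact h
  | succ q => exact h.1

/-! ### The pebble game and counting logic -/

theorem PebbleEquiv.holds_iff [DecidableEq ι] {G : SimpleGraph V} {H : SimpleGraph W} {e : ι → ℕ}
    (he : e.Injective) (φ : Formula) (hφ : (φ.vars : Set ℕ) ⊆ Set.range e) {q : ℕ}
    (hq : φ.qr ≤ q) {ν : ℕ → Option V} {μ : ℕ → Option W}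
    (h : PebbleEquiv G H q (ν ∘ e) (μ ∘ e)) : φ.Holds G ν ↔ φ.Holds H μ := by
  induction φ generalizing q ν μ with
  | eq i j =>
    obtain ⟨i, rfl⟩ := hφ (by simp [Formula.vars] : i ∈ _)
    obtain ⟨j, rfl⟩ := hφ (by simp [Formula.vars] : j ∈ _)
    exact (h.atomic i j).1
  | adj i j =>
    obtain ⟨i, rfl⟩ := hφ (by simp [Formula.vars] : i ∈ _)
    obtain ⟨j, rfl⟩ := hφ (by simp [Formula.vars] : j ∈ _)
    exact (h.atomic i j).2
  | neg φ ih => exact not_congr (ih hφ hq h)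
  | and φ ψ ih1 ih2 =>
    simp only [Formula.vars, Finset.coe_union, Set.union_subset_iff] at hφ
    simp only [Formula.qr, max_le_iff] at hq
    exact and_congr (ih1 hφ.1 hq.1 h) (ih2 hφ.2 hq.2 h)
  | or φ ψ ih1 ih2 =>
    simp only [Formula.vars, Finset.coe_union, Set.union_subset_iff] at hφ
    simp only [Formula.qr, max_le_iff] at hq
    exact or_congr (ih1 hφ.1 hq.1 h) (ih2 hφ.2 hq.2 h)
  | imp φ ψ ih1 ih2 =>
    simp only [Formula.vars, Finset.coe_union, Set.union_subset_iff] at hφ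
    simp only [Formula.qr, max_le_iff] at hq
    exact imp_congr (ih1 hφ.1 hq.1 h) (ih2 hφ.2 hq.2 h)
  | all i φ ih | ex i φ ih | exGe t i φ ih =>
    simp only [Formula.vars, Finset.coe_insert, Set.insert_subset_iff] at hφ
    obtain ⟨⟨i, rfl⟩, hφ⟩ := hφ
    simp only [Formula.qr] at hq
    obtain ⟨q, rfl⟩ : ∃ r, q = r + 1 := ⟨q - 1, by omega⟩
    obtain ⟨β, hβ⟩ := h.2 i
    have ih' (a : V) : φ.Holds G (Function.update ν (e i) (some a)) ↔
        φ.Holds H (Function.update μ (e i) (some (β a))) := by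
      refine ih hφ (q := q) (by omega) ?_
      rw [Function.update_comp_eq_of_injective _ he, Function.update_comp_eq_of_injective _ he]
      exact hβ a
    -- The same `β` serves all three quantifiers; for the counting one it transports the witness
    -- set.
    first
    | exact β.forall_congr ih'
    | exact β.exists_congr ih'
    | constructor
      · rintro ⟨s, hs, h⟩
        refine ⟨s.map β.toEmbedding, by simpa using hs, fun b hb => ?_⟩
        obtain ⟨a, ha, rfl⟩ := Finset.mem_map.1 hb
        exact (ih' a).1 (h a ha)
      · rintro ⟨s, hs, h⟩
        refine ⟨s.map β.symm.toEmbedding, by simpa using hs, fun b hb => ?_⟩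
        obtain ⟨a, ha, rfl⟩ := Finset.mem_map.1 hb
        exact (ih' _).2 (by simpa using h a ha)

theorem boole_eq_mul {p q r : Prop} [Decidable p] [Decidable q] [Decidable r] (h : r ↔ p ∧ q) :
    (if r then 1 else 0 : ℤ) = (if p then 1 else 0) * if q then 1 else 0 := by
  by_cases hp : p <;> by_cases hq : q <;> simp [h, hp, hq]

theorem atomicEquiv_of_holds_iff {G : SimpleGraph V} {H : SimpleGraph W} {e : ι → ℕ} {q : ℕ}
    {ν : ℕ → Option V} {μ : ℕ → Option W} (hdom : ∀ i, ν i = none ↔ μ i = none)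
    (h : ∀ φ : Formula, (φ.vars : Set ℕ) ⊆ Set.range e → φ.qr ≤ q →
      (∀ i ∈ φ.free, ν i ≠ none) → (φ.Holds G ν ↔ φ.Holds H μ)) :
    AtomicEquiv G H (ν ∘ e) (μ ∘ e) := by
  intro i j
  by_cases hd : ν (e i) ≠ none ∧ ν (e j) ≠ none
  · refine ⟨h (.eq (e i) (e j)) ?_ (Nat.zero_le _) ?_, h (.adj (e i) (e j)) ?_ (Nat.zero_le _) ?_⟩
    all_goals simp [Formula.vars, Formula.free, Set.insert_subset_iff, hd]
  -- Atoms at an unplaced pebble are false, and `hdom` makes this happen in both graphs.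
  · rw [not_and_or, not_not, not_not] at hd
    rcases hd with hd | hd <;> simp [OptEq, OptAdj, hd, (hdom _).1 hd]

/-- The test functions are the truth values of formulae of smaller rank; conjunction multiplies them
and counting quantifiers give their sums. The restriction to interpreted free variables leaves
exactly the sentences at the empty position. -/
theorem pebbleEquiv_of_holds_iff [DecidableEq ι] [Finite V] [Finite W] {G : SimpleGraph V}
    {H : SimpleGraph W} {e : ι → ℕ} (he : e.Injective) {q : ℕ} {ν : ℕ → Option V}
    {μ : ℕ → Option W} (hdom : ∀ i, ν i = none ↔ μ i = none)
    (h : ∀ φ : Formula, (φ.vars : Set ℕ) ⊆ Set.range e → φ.qr ≤ q →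
      (∀ i ∈ φ.free, ν i ≠ none) → (φ.Holds G ν ↔ φ.Holds H μ)) :
    PebbleEquiv G H q (ν ∘ e) (μ ∘ e) := by
  classical
  cases nonempty_fintype V
  cases nonempty_fintype W
  induction q generalizing ν μ with
  | zero => exact atomicEquiv_of_holds_iff hdom h
  | succ q ih =>
    refine ⟨atomicEquiv_of_holds_iff hdom h, fun i => ?_⟩
    let T := {φ : Formula // (φ.vars : Set ℕ) ⊆ Set.range e ∧ φ.qr ≤ q ∧
      ∀ l ∈ φ.free, l = e i ∨ ν l ≠ none}
    obtain ⟨β, hβ⟩ := exists_equiv_of_sum_eq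
      (fun (φ : T) a => if φ.1.Holds G (Function.update ν (e i) (some a)) then 1 else 0)
      (fun (φ : T) b => if φ.1.Holds H (Function.update μ (e i) (some b)) then 1 else 0)
      -- The formula `x_i = x_i` replaces a truth constant.
      ⟨⟨.eq (e i) (e i), by simp [Formula.vars], Nat.zero_le _, by simp [Formula.free]⟩,
        by simp [Formula.Holds], by simp [Formula.Holds]⟩
      (fun s t => ⟨⟨.and s.1 t.1, by simp [Formula.vars, s.2.1, t.2.1],
        max_le s.2.2.1 t.2.2.1, fun l hl => (Finset.mem_union.1 hl).elim (s.2.2.2 l) (t.2.2.2 l)⟩,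
        fun a => boole_eq_mul Iff.rfl, fun a => boole_eq_mul Iff.rfl⟩)
      (fun φ => by
        have hex (n : ℕ) := h (.exGe n (e i) φ.1)
          (by simp [Formula.vars, Set.insert_subset_iff, φ.2.1])
          (by simp only [Formula.qr]; have := φ.2.2.1; omega)
          (fun l hl => (φ.2.2.2 l (Finset.mem_of_mem_erase hl)).resolve_left
            (Finset.ne_of_mem_erase hl))
        simp only [Finset.sum_boole]
        congr 1
        -- Each inequality uses the counting quantifier whose threshold is the exact number of
        -- solutions in one of the graphs.
        apply le_antisymm
        · obtain ⟨s, hs, hs'⟩ := (hex _).1 ⟨_, rfl, fun a ha => (Finset.mem_filter.1 ha).2⟩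
          rw [← hs]
          exact Finset.card_le_card fun a ha => by simpa using hs' a ha
        · obtain ⟨s, hs, hs'⟩ := (hex _).2 ⟨_, rfl, fun a ha => (Finset.mem_filter.1 ha).2⟩
          rw [← hs]
          exact Finset.card_le_card fun a ha => by simpa using hs' a ha)
    refine ⟨β, fun a => ?_⟩
    rw [← Function.update_comp_eq_of_injective _ he, ← Function.update_comp_eq_of_injective _ he]
    have hdom' (l : ℕ) : Function.update ν (e i) (some a) l = none ↔
        Function.update μ (e i) (some (β a)) l = none := by
      by_cases hl : l = e i
      · subst hl; simp
      · simp [hl, hdom]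
    have hh (φ : Formula) (h1 : (φ.vars : Set ℕ) ⊆ Set.range e) (h2 : φ.qr ≤ q)
        (h3 : ∀ l ∈ φ.free, Function.update ν (e i) (some a) l ≠ none) :
        φ.Holds G (Function.update ν (e i) (some a)) ↔
          φ.Holds H (Function.update μ (e i) (some (β a))) := by
      have := hβ ⟨φ, h1, h2, fun l hl => or_iff_not_imp_left.2 fun hne => by
        simpa [hne] using h3 l hl⟩ a
      by_cases h4 : φ.Holds G (Function.update ν (e i) (some a)) <;>
      by_cases h5 : φ.Holds H (Function.update μ (e i) (some (β a))) <;> simp_all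
    exact ih hdom' hh

end Games

/-! ### The pebble game determines homomorphism counts -/

section Extensions

variable {ι : Type*} {V : Type u} {W : Type v} {U : Type*}

/-- The homomorphisms from the part `X` of `F` to `G`, as partial maps, where an edge from a
vertex `u` outside `X` into `X` is read as an edge from the vertex under the pebble `p u`. -/
def IsExtension (F : SimpleGraph U) (p : U → ι) (G : SimpleGraph V) (X : Set U)
    (ν : ι → Option V) (h : U → Option V) : Prop :=
  (∀ u, h u = none ↔ u ∉ X) ∧ ∀ x ∈ X, ∀ u, F.Adj u x → OptAdj G ((h u).or (ν (p u))) (h x)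

open Classical in
/-- The number of homomorphisms from the part `X` of `F` to `G` at a position. -/
noncomputable def extCount [Fintype U] [Fintype V] (F : SimpleGraph U) (p : U → ι)
    (G : SimpleGraph V) (X : Set U) (ν : ι → Option V) : ℕ :=
  Finset.card {h : U → Option V | IsExtension F p G X ν h}

theorem extCount_empty [Fintype U] [Fintype V] (F : SimpleGraph U) (p : U → ι)
    (G : SimpleGraph V) (ν : ι → Option V) : extCount F p G ∅ ν = 1 := by
  rw [extCount, Finset.card_eq_one]
  refine ⟨fun _ => none, ?_⟩
  ext h
  simp [IsExtension, funext_iff]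

/-- No vertex lies outside the part, so no edge is read from a pebble and the position is
irrelevant. -/
theorem extCount_univ [Fintype U] [Fintype V] (F : SimpleGraph U) (p : U → ι)
    (G : SimpleGraph V) (ν : ι → Option V) : extCount F p G Set.univ ν = homCount F G := by
  classical
  rw [extCount, homCount, ← Fintype.card_subtype, ← Nat.card_eq_fintype_card]
  symm
  refine Nat.card_congr (Equiv.ofBijective
    (fun h : F →g G => ⟨fun u => some (h u), by simp, fun x _ u hu => ?_⟩) ⟨?_, ?_⟩)
  · exact optAdj_some.2 (h.map_adj hu)
  · intro h h' hh
    ext u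
    simpa using congrFun (congrArg Subtype.val hh) u
  · rintro ⟨h, h1, h2⟩
    have h3 (u) : ∃ a, h u = some a := Option.ne_none_iff_exists'.1 fun hu => (h1 u).1 hu trivial
    choose f hf using h3
    refine ⟨⟨f, fun {x y} hxy => ?_⟩, Subtype.ext (funext fun u => (hf u).symm)⟩
    simpa [hf, optAdj_some] using h2 y trivial x hxy

/-- A neighbour of one part that lies outside it also lies outside the other, so it is read from its
pebble in all three counts and the conditions decouple. -/
theorem extCount_union [Fintype U] [Fintype V] (F : SimpleGraph U) (p : U → ι)
    (G : SimpleGraph V) {A B : Set U} (hd : Disjoint A B)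
    (hAB : ∀ a ∈ A, ∀ b ∈ B, ¬ F.Adj a b) (ν : ι → Option V) :
    extCount F p G (A ∪ B) ν = extCount F p G A ν * extCount F p G B ν := by
  classical
  have hA (u) (hu : u ∈ A) : u ∉ B := Set.disjoint_left.1 hd hu
  rw [extCount, extCount, extCount, ← Finset.card_product]
  refine Finset.card_nbij' (fun h => (fun u => if u ∈ A then h u else none,
    fun u => if u ∈ B then h u else none)) (fun h u => (h.1 u).or (h.2 u)) ?_ ?_ ?_ ?_
  · intro h hh
    simp only [Finset.coe_filter, Finset.mem_univ, true_and, Set.mem_ofPred_eq] at hh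
    obtain ⟨h1, h2⟩ := hh
    simp only [Finset.coe_product, Finset.coe_filter, Finset.mem_univ, true_and, Set.mem_prod,
      Set.mem_ofPred_eq]
    refine ⟨⟨fun u => ?_, fun x hx u hu => ?_⟩, ⟨fun u => ?_, fun x hx u hu => ?_⟩⟩
    · by_cases hu : u ∈ A <;> simp [hu, h1]
    · have := h2 x (Or.inl hx) u hu
      by_cases hA : u ∈ A
      · simpa [hA, hx] using this
      · have hB : u ∉ B := fun hB => hAB x hx u hB hu.symm
        have : h u = none := by simp [h1, hA, hB]
        simp_all
    · by_cases hu : u ∈ B <;> simp [hu, h1]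
    · have := h2 x (Or.inr hx) u hu
      by_cases hB : u ∈ B
      · simpa [hB, hx] using this
      · have hA : u ∉ A := fun hA => hAB u hA x hx hu
        have : h u = none := by simp [h1, hA, hB]
        simp_all
  · rintro ⟨f, g⟩ hh
    simp only [Finset.coe_product, Finset.coe_filter, Finset.mem_univ, true_and, Set.mem_prod,
      Set.mem_ofPred_eq] at hh
    obtain ⟨⟨f1, f2⟩, g1, g2⟩ := hh
    simp only [Finset.coe_filter, Finset.mem_univ, true_and, Set.mem_ofPred_eq]
    refine ⟨fun u => by simp [f1, g1], fun x hx u hu => ?_⟩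
    rcases hx with hx | hx
    · have hB : u ∉ B := fun hB => hAB x hx u hB hu.symm
      beta_reduce
      rw [(g1 u).2 hB, (g1 x).2 (hA x hx), Option.or_none, Option.or_none]
      exact f2 x hx u hu
    · have hA' : u ∉ A := fun hA => hAB u hA x hx hu
      beta_reduce
      rw [(f1 u).2 hA', (f1 x).2 fun h => hA x h hx, Option.none_or, Option.none_or]
      exact g2 x hx u hu
  · intro h hh
    simp only [Finset.coe_filter, Finset.mem_univ, true_and, Set.mem_ofPred_eq] at hh
    funext u
    have := hh.1 u
    by_cases hA : u ∈ A <;> by_cases hB : u ∈ B <;> simp_all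
  · rintro ⟨f, g⟩ hh
    simp only [Finset.coe_product, Finset.coe_filter, Finset.mem_univ, true_and, Set.mem_prod,
      Set.mem_ofPred_eq] at hh
    obtain ⟨⟨f1, f2⟩, g1, g2⟩ := hh
    refine Prod.ext (funext fun u => ?_) (funext fun u => ?_)
    · by_cases hu : u ∈ A
      · simp [hu, (g1 u).2 (hA u hu)]
      · simp [hu, (f1 u).2 hu]
    · by_cases hu : u ∈ B
      · simp [hu, (f1 u).2 fun h => hA u h hu]
      · simp [hu, (g1 u).2 hu]

/-- The sum runs over the image of `r`. By `hp`, no edge into the remaining part still needs the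
former place of the pebble `p r`, so it can be moved onto that image, where it records the edges
from `r`. -/
theorem extCount_root [DecidableEq ι] [Fintype U] [Fintype V] (F : SimpleGraph U) (p : U → ι)
    (G : SimpleGraph V) {X : Set U} {r : U} (hr : r ∈ X) (ν : ι → Option V)
    (hp : ∀ x ∈ X, x ≠ r → ∀ u ∉ X, F.Adj u x → p u ≠ p r)
    [DecidablePred fun a => ∀ u ∉ X, F.Adj u r → OptAdj G (ν (p u)) (some a)] :
    extCount F p G X ν = ∑ a : V, if ∀ u ∉ X, F.Adj u r → OptAdj G (ν (p u)) (some a) then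
      extCount F p G (X \ {r}) (Function.update ν (p r) (some a)) else 0 := by
  classical
  rw [extCount, Finset.card_eq_sum_card_fiberwise (f := fun h => h r)
    (t := Finset.univ) fun h _ => Finset.mem_coe.2 (Finset.mem_univ _), Fintype.sum_option]
  have hnone : ({h ∈ ({h : U → Option V | IsExtension F p G X ν h} : Finset _) | h r = none} :
      Finset _) = ∅ := by
    ext h
    simp only [Finset.mem_filter, Finset.mem_univ, true_and, Finset.notMem_empty, iff_false]
    rintro ⟨h1, h2⟩
    exact (h1.1 r).1 h2 hr
  rw [hnone, Finset.card_empty, zero_add]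
  refine Finset.sum_congr rfl fun a _ => ?_
  have fwd (h : U → Option V) (hh : IsExtension F p G X ν h) (ha : h r = some a) :
      (∀ u ∉ X, F.Adj u r → OptAdj G (ν (p u)) (some a)) ∧
      IsExtension F p G (X \ {r}) (Function.update ν (p r) (some a))
        (Function.update h r none) := by
    refine ⟨fun u hu hur => ?_, fun u => ?_, fun x hx u hu => ?_⟩
    · simpa [(hh.1 u).2 hu, ha] using hh.2 r hr u hur
    · by_cases hur : u = r
      · simp [hur]
      · simp [hur, hh.1]
    · have hxr : x ≠ r := hx.2
      have := hh.2 x hx.1 u hu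
      rw [Function.update_of_ne hxr]
      by_cases hur : u = r
      · subst hur
        simpa [ha] using this
      · rw [Function.update_of_ne hur]
        by_cases huX : u ∈ X
        · obtain ⟨b, hb⟩ := Option.ne_none_iff_exists'.1 fun h => (hh.1 u).1 h huX
          simpa [hb] using this
        · rw [Function.update_of_ne (hp x hx.1 hxr u huX hu)]
          exact this
  have bwd (h : U → Option V) (hc : ∀ u ∉ X, F.Adj u r → OptAdj G (ν (p u)) (some a))
      (hh : IsExtension F p G (X \ {r}) (Function.update ν (p r) (some a)) h) :
      IsExtension F p G X ν (Function.update h r (some a)) := by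
    refine ⟨fun u => ?_, fun x hx u hu => ?_⟩
    · by_cases hur : u = r
      · simp [hur, hr]
      · simp [hur, hh.1]
    · have hr0 : h r = none := (hh.1 r).2 (by simp)
      by_cases hxr : x = r
      · subst hxr
        rw [Function.update_self, Function.update_of_ne hu.ne]
        by_cases huX : u ∈ X
        · have := optAdj_symm (hh.2 u ⟨huX, hu.ne⟩ x hu.symm)
          obtain ⟨b, hb⟩ := Option.ne_none_iff_exists'.1 fun h => (hh.1 u).1 h ⟨huX, hu.ne⟩
          simpa [hb, hr0] using this
        · rw [(hh.1 u).2 fun h => huX h.1]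
          exact hc u huX hu
      · have := hh.2 x ⟨hx, hxr⟩ u hu
        rw [Function.update_of_ne hxr]
        by_cases hur : u = r
        · subst hur
          simpa [hr0] using this
        · rw [Function.update_of_ne hur]
          by_cases huX : u ∈ X
          · obtain ⟨b, hb⟩ := Option.ne_none_iff_exists'.1 fun h => (hh.1 u).1 h ⟨huX, hur⟩
            simpa [hb] using this
          · rwa [Function.update_of_ne (hp x hx hxr u huX hu)] at this
  split_ifs with hc
  · rw [extCount]
    refine Finset.card_nbij' (fun h => Function.update h r none)
      (fun h => Function.update h r (some a)) ?_ ?_ ?_ ?_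
    · intro h hh
      simp only [Finset.coe_filter, Finset.mem_filter, Finset.mem_univ, true_and,
        Set.mem_ofPred_eq] at hh ⊢
      exact (fwd h hh.1 hh.2).2
    · intro h hh
      simp only [Finset.coe_filter, Finset.mem_filter, Finset.mem_univ, true_and,
        Set.mem_ofPred_eq] at hh ⊢
      exact ⟨bwd h hc hh, by simp⟩
    · intro h hh
      simp only [Finset.coe_filter, Finset.mem_filter, Finset.mem_univ, true_and,
        Set.mem_ofPred_eq] at hh
      simp [← hh.2]
    · intro h hh
      simp only [Finset.coe_filter, Finset.mem_univ, true_and, Set.mem_ofPred_eq] at hh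
      have : h r = none := (hh.1 r).2 (by simp)
      simp [← this]
  · rw [Finset.card_eq_zero]
    ext h
    simp only [Finset.mem_filter, Finset.mem_univ, true_and, Finset.notMem_empty, iff_false]
    exact fun hh => hc (fwd h hh.1 hh.2).1

end Extensions

/-- Induction on an upward closed part `X`. If a minimal vertex lies below all of `X`, one round is
spent on it and all chains in the rest are shorter than `q`; otherwise `X` splits into two parts
without edges between them, at no cost in rounds. -/
theorem PebbleEquiv.extCount_eq {k : ℕ} {U : Type*} [Fintype U] {V : Type u} {W : Type v}
    [Fintype V] [Fintype W] {G : SimpleGraph V} {H : SimpleGraph W} {F : SimpleGraph U}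
    (C : PebbleForestCover k F) (X : Finset U)
    (hX : ∀ x ∈ X, ∀ y, C.forest.le x y → y ∈ X) (q : ℕ)
    (hq : ∀ s ⊆ X, IsChain C.forest.le (s : Set U) → s.card ≤ q)
    {ν : Fin k → Option V} {μ : Fin k → Option W} (h : PebbleEquiv G H q ν μ) :
    extCount F C.pebble G X ν = extCount F C.pebble H X μ := by
  classical
  induction X using Finset.strongInduction generalizing q ν μ with
  | H X ih =>
  obtain rfl | hne := X.eq_empty_or_nonempty
  · simp [extCount_empty]
  let T := C.forest
  -- A vertex with the fewest ancestors is minimal in `X`.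
  obtain ⟨r, hr, hmin⟩ := X.exists_min_image
    (fun x => Finset.card ({w | T.le w x} : Finset U)) hne
  have hmin' (x) (hx : x ∈ X) (hxr : T.le x r) : x = r := by
    by_contra hne
    refine (hmin x hx).not_gt (Finset.card_lt_card ?_)
    rw [Finset.ssubset_iff_of_subset]
    · exact ⟨r, by simp [T.le_refl], by simpa using fun h => hne (T.le_antisymm _ _ hxr h)⟩
    · intro w hw
      simp only [Finset.mem_filter, Finset.mem_univ, true_and] at hw ⊢
      exact T.le_trans _ _ _ hw hxr
  by_cases hall : ∀ x ∈ X, T.le r x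
  · have hchain (s : Finset U) (hs : s ⊆ X \ {r}) (hc : IsChain T.le (s : Set U)) :
        s.card + 1 ≤ q := by
      have hrs : r ∉ s := fun h => by simpa using hs h
      rw [← Finset.card_insert_of_notMem hrs]
      refine hq _ (Finset.insert_subset hr (hs.trans Finset.sdiff_subset)) ?_
      rw [Finset.coe_insert]
      exact hc.insert fun b hb _ => Or.inl (hall b (Finset.sdiff_subset (hs hb)))
    obtain ⟨q, rfl⟩ : ∃ m, q = m + 1 :=
      ⟨q - 1, by have := hchain ∅ (by simp) (by simp); simp at this; omega⟩
    -- Here the pebble condition enters: `u` is strictly below `r`, and `r` lies on the path from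
    -- `u` to its neighbour `x`.
    have hout (x) (hx : x ∈ X) (u) (hu : u ∉ X) (hux : F.Adj u x) : C.pebble u ≠ C.pebble r := by
      have hle : T.le u x := (C.adj_comparable u x hux).resolve_right fun h => hu (hX x hx u h)
      have hur : T.le u r := (T.comparable_below u r x hle (hall x hx)).resolve_right
        fun h => hu (hX r hr u h)
      exact C.pebble_ne u x hux ⟨hle, hux.ne⟩ r ⟨hur, fun h => hu (h ▸ hr)⟩ (hall x hx)
    obtain ⟨β, hβ⟩ := h.2 (C.pebble r)
    rw [extCount_root F C.pebble G (Finset.mem_coe.2 hr) ν fun x hx _ => hout x hx,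
      extCount_root F C.pebble H (Finset.mem_coe.2 hr) μ fun x hx _ => hout x hx]
    refine Fintype.sum_equiv β _ _ fun a => ?_
    have hiff : (∀ u ∉ (X : Set U), F.Adj u r → OptAdj G (ν (C.pebble u)) (some a)) ↔
        ∀ u ∉ (X : Set U), F.Adj u r → OptAdj H (μ (C.pebble u)) (some (β a)) := by
      refine forall_congr' fun u => forall_congr' fun hu => forall_congr' fun hur => ?_
      have := ((hβ a).atomic (C.pebble u) (C.pebble r)).2
      simpa [Function.update_of_ne (hout r hr u hu hur)] using this
    have hrec := ih (X \ {r}) (Finset.sdiff_ssubset (by simpa using hr) (by simp))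
      (fun x hx y hxy => by
        simp only [Finset.mem_sdiff, Finset.mem_singleton] at hx ⊢
        refine ⟨hX x hx.1 y hxy, ?_⟩
        rintro rfl
        exact hx.2 (hmin' x hx.1 hxy)) q
      (fun s hs hc => Nat.le_of_succ_le_succ (hchain s hs hc)) (hβ a)
    rw [Finset.coe_sdiff, Finset.coe_singleton] at hrec
    simp only [hiff, hrec]
  · let A : Finset U := {x ∈ X | T.le r x}
    let B : Finset U := {x ∈ X | ¬ T.le r x}
    have hXAB : (X : Set U) = (A : Set U) ∪ (B : Set U) := by
      rw [← Finset.coe_union, Finset.filter_union_filter_not_eq]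
    have hA : ∀ x ∈ A, ∀ y, T.le x y → y ∈ A := by
      intro x hx y hxy
      simp only [A, Finset.mem_filter] at hx ⊢
      exact ⟨hX x hx.1 y hxy, T.le_trans _ _ _ hx.2 hxy⟩
    have hB : ∀ x ∈ B, ∀ y, T.le x y → y ∈ B := by
      intro x hx y hxy
      simp only [B, Finset.mem_filter] at hx ⊢
      refine ⟨hX x hx.1 y hxy, fun hry => hx.2 ?_⟩
      -- Two vertices below `y` are comparable, so minimality of `r` forces `r` below `x`.
      rcases T.comparable_below x r y hxy hry with h | h
      · rw [hmin' x hx.1 h]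
        exact T.le_refl r
      · exact h
    have hdisj : Disjoint A B := Finset.disjoint_filter_filter_not _ _ _
    have hedge : ∀ a ∈ (A : Set U), ∀ b ∈ (B : Set U), ¬ F.Adj a b := by
      intro a ha b hb hab
      rcases C.adj_comparable a b hab with h | h
      · exact Finset.disjoint_left.1 hdisj (hA a ha b h) hb
      · exact Finset.disjoint_left.1 hdisj ha (hB b hb a h)
    have hAX : A ⊂ X := by
      push Not at hall
      obtain ⟨x, hx, hrx⟩ := hall
      exact Finset.filter_ssubset.2 ⟨x, hx, hrx⟩
    have hBX : B ⊂ X := Finset.filter_ssubset.2 ⟨r, hr, by simpa using T.le_refl r⟩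
    have hd : Disjoint (A : Set U) (B : Set U) := Finset.disjoint_coe.2 hdisj
    rw [hXAB, extCount_union F _ G hd hedge, extCount_union F _ H hd hedge,
      ih A hAX hA q (fun s hs => hq s (hs.trans hAX.1)) h,
      ih B hBX hB q (fun s hs => hq s (hs.trans hBX.1)) h]

theorem PebbleEquiv.homCount_eq {k q : ℕ} {U : Type*} [Finite U] {V : Type u} {W : Type v}
    [Finite V] [Finite W] {G : SimpleGraph V} {H : SimpleGraph W} {F : SimpleGraph U}
    (C : PebbleForestCover k F) (hC : C.forest.height ≤ q)
    {ν : Fin k → Option V} {μ : Fin k → Option W} (h : PebbleEquiv G H q ν μ) :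
    homCount F G = homCount F H := by
  cases nonempty_fintype U
  cases nonempty_fintype V
  cases nonempty_fintype W
  rw [← extCount_univ F C.pebble G ν, ← extCount_univ F C.pebble H μ, ← Finset.coe_univ]
  refine h.extCount_eq C Finset.univ (by simp) q fun s _ hs => ?_
  exact_mod_cast (le_iSup₂ (f := fun (s : Finset U) (_ : IsChain C.forest.le (s : Set U)) =>
    (s.card : ℕ∞)) s hs).trans hC

/-! ### Homomorphism terms -/

/-- Expressions for homomorphism counts of graphs with free vertices `ι`. -/
inductive HomTerm (ι : Type) : Type
  | one : HomTerm ι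
  | adj (i j : ι) : HomTerm ι
  | mul (s t : HomTerm ι) : HomTerm ι
  /-- summation over all values of the vertex `i` -/
  | sum (i : ι) (t : HomTerm ι) : HomTerm ι

namespace HomTerm

variable {ι : Type} {V : Type u} {W : Type v}

/-- The nesting depth of summations. -/
def depth : HomTerm ι → ℕ
  | one => 0
  | adj _ _ => 0
  | mul s t => max s.depth t.depth
  | sum _ t => t.depth + 1

open Classical in
/-- The value of a term in a graph at a position. -/
noncomputable def val [DecidableEq ι] [Fintype V] (G : SimpleGraph V) : HomTerm ι → (ι → Option V) → ℕ
  | one, _ => 1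
  | adj i j, ν => if OptAdj G (ν i) (ν j) then 1 else 0
  | mul s t, ν => s.val G ν * t.val G ν
  | sum i t, ν => ∑ a : V, t.val G (Function.update ν i (some a))

/-- Renaming of the vertices by a permutation. -/
def rename (σ : ι ≃ ι) : HomTerm ι → HomTerm ι
  | one => one
  | adj i j => adj (σ i) (σ j)
  | mul s t => mul (s.rename σ) (t.rename σ)
  | sum i t => sum (σ i) (t.rename σ)

theorem depth_rename (σ : ι ≃ ι) (t : HomTerm ι) : (t.rename σ).depth = t.depth := by
  induction t <;> simp_all [depth, rename]

theorem val_rename [DecidableEq ι] [Fintype V] (G : SimpleGraph V) (σ : ι ≃ ι) (t : HomTerm ι)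
    (ν : ι → Option V) : (t.rename σ).val G ν = t.val G (ν ∘ σ) := by
  induction t generalizing ν with
  | one => rfl
  | adj i j => rfl
  | mul s t ihs iht => simp only [rename, val, ihs, iht]
  | sum i t ih =>
    simp only [rename, val, ih]
    refine Finset.sum_congr rfl fun a _ => ?_
    congr 1
    funext j
    by_cases h : j = i <;> simp [h]

variable [DecidableEq ι]

/-- Identification of the free vertex `i` with the free vertex `j`. -/
def subst (i j : ι) : HomTerm ι → HomTerm ι
  | one => one
  | adj a b => adj (if a = i then j else a) (if b = i then j else b)
  | mul s t => mul (s.subst i j) (t.subst i j)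
  | sum l t =>
    if l = i then sum i t
    -- Here the bound `j` would capture the new free `j`. Swapping the two names avoids this without
    -- a fresh variable, so the number of pebbles does not grow.
    else if l = j then sum i (t.rename (Equiv.swap i j))
    else sum l (t.subst i j)

theorem depth_subst (i j : ι) (t : HomTerm ι) : (t.subst i j).depth = t.depth := by
  induction t with
  | one => rfl
  | adj a b => rfl
  | mul s t ihs iht => simp only [subst, depth, ihs, iht]
  | sum l t ih =>
    rw [subst]
    split_ifs <;> simp [depth, depth_rename, ih]

theorem val_subst [Fintype V] (G : SimpleGraph V) {i j : ι} (hij : i ≠ j) (t : HomTerm ι)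
    (ν : ι → Option V) : (t.subst i j).val G ν = t.val G (Function.update ν i (ν j)) := by
  induction t generalizing ν with
  | one => rfl
  | adj a b =>
    have h (a : ι) : ν (if a = i then j else a) = Function.update ν i (ν j) a := by
      by_cases ha : a = i <;> simp [ha]
    simp only [subst, val]
    rw [h a, h b]
  | mul s t ihs iht => simp only [subst, val, ihs, iht]
  | sum l t ih =>
    rw [subst]
    split_ifs with h1 h2
    · subst h1
      simp only [val, Function.update_idem]
    · subst h2
      simp only [val, val_rename]
      refine Finset.sum_congr rfl fun a _ => ?_
      congr 1
      funext m
      by_cases hm : m = l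
      · subst hm; simp
      · by_cases hm' : m = i
        · subst hm'; simp [hm, hij.symm]
        · simp [hm, hm', Equiv.swap_apply_of_ne_of_ne]
    · simp only [val, ih]
      refine Finset.sum_congr rfl fun a _ => ?_
      rw [Function.update_of_ne (Ne.symm h2), Function.update_comm h1]

end HomTerm

/-! ### From term values to the pebble game -/

variable {ι : Type} {V : Type u} {W : Type v}

/-- Terms have no equality atom, so coincidences of pebbles are carried separately by `heq`. To
preserve them, the test functions are terms multiplied by indicators that given pebbles lie on the
chosen vertex. -/
theorem pebbleEquiv_of_val_eq [DecidableEq ι] [Fintype V] [Fintype W] {G : SimpleGraph V} {H : SimpleGraph W}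
    {q : ℕ} {ν : ι → Option V} {μ : ι → Option W}
    (heq : ∀ i j, OptEq (ν i) (ν j) ↔ OptEq (μ i) (μ j))
    (h : ∀ t : HomTerm ι, t.depth ≤ q → t.val G ν = t.val H μ) : PebbleEquiv G H q ν μ := by
  classical
  have hat (i j) : OptAdj G (ν i) (ν j) ↔ OptAdj H (μ i) (μ j) := by
    have := h (.adj i j) (Nat.zero_le _)
    simp only [HomTerm.val] at this
    by_cases h1 : OptAdj G (ν i) (ν j) <;> by_cases h2 : OptAdj H (μ i) (μ j) <;> simp_all
  induction q generalizing ν μ with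
  | zero => exact fun i j => ⟨heq i j, hat i j⟩
  | succ q ih =>
    refine ⟨fun i j => ⟨heq i j, hat i j⟩, fun i => ?_⟩
    let T := Set ι × {t : HomTerm ι // t.depth ≤ q}
    obtain ⟨β, hβ⟩ := exists_equiv_of_sum_eq
      (fun (t : T) a => if ∀ j ∈ t.1, j ≠ i → ν j = some a then
        (t.2.1.val G (Function.update ν i (some a)) : ℤ) else 0)
      (fun (t : T) b => if ∀ j ∈ t.1, j ≠ i → μ j = some b then
        (t.2.1.val H (Function.update μ i (some b)) : ℤ) else 0)
      ⟨⟨∅, .one, Nat.zero_le _⟩, by simp [HomTerm.val], by simp [HomTerm.val]⟩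
      (fun s t => ⟨⟨s.1 ∪ t.1, .mul s.2.1 t.2.1, max_le s.2.2 t.2.2⟩, fun a => by
          simp only [Set.mem_union, or_imp, forall_and, HomTerm.val, Nat.cast_mul, ite_and]
          split_ifs <;> simp,
        fun a => by
          simp only [Set.mem_union, or_imp, forall_and, HomTerm.val, Nat.cast_mul, ite_and]
          split_ifs <;> simp⟩)
      (fun ⟨J, t, ht⟩ => by
        -- If `J` holds some `j ≠ i`, the sum either collapses to the vertex under `j`, which
        -- amounts to identifying `i` with `j` in the term, or is empty in both graphs. Otherwise it
        -- is a sum over `i`, one level deeper.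
        by_cases hJ : ∃ j ∈ J, j ≠ i
        · obtain ⟨j, hj, hji⟩ := hJ
          by_cases hall : ∀ l ∈ J, l ≠ i → OptEq (ν j) (ν l)
          · have hall' : ∀ l ∈ J, l ≠ i → OptEq (μ j) (μ l) := fun l hl hli =>
              (heq j l).1 (hall l hl hli)
            obtain ⟨a, ha, -⟩ := hall j hj hji
            obtain ⟨b, hb, -⟩ := hall' j hj hji
            have e1 (x) : (∀ l ∈ J, l ≠ i → ν l = some x) ↔ x = a := by
              constructor
              · intro hx
                simpa [ha, eq_comm] using hx j hj hji
              · rintro rfl l hl hli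
                obtain ⟨c, h1, h2⟩ := hall l hl hli
                rw [h2, ← h1, ha]
            have e2 (x) : (∀ l ∈ J, l ≠ i → μ l = some x) ↔ x = b := by
              constructor
              · intro hx
                simpa [hb, eq_comm] using hx j hj hji
              · rintro rfl l hl hli
                obtain ⟨c, h1, h2⟩ := hall' l hl hli
                rw [h2, ← h1, hb]
            simp only [e1, e2, Finset.sum_ite_eq', Finset.mem_univ, if_true]
            have := h (t.subst i j) (by rw [t.depth_subst]; omega)
            rw [t.val_subst G hji.symm, t.val_subst H hji.symm, ha, hb] at this
            exact_mod_cast this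
          · have hall' : ¬ ∀ l ∈ J, l ≠ i → OptEq (μ j) (μ l) := fun hh => hall fun l hl hli =>
              (heq j l).2 (hh l hl hli)
            have e1 (x) : ¬ ∀ l ∈ J, l ≠ i → ν l = some x := fun hx =>
              hall fun l hl hli => ⟨x, hx j hj hji, hx l hl hli⟩
            have e2 (x) : ¬ ∀ l ∈ J, l ≠ i → μ l = some x := fun hx =>
              hall' fun l hl hli => ⟨x, hx j hj hji, hx l hl hli⟩
            simp only [e1, e2, if_false, Finset.sum_const_zero]
        · push Not at hJ
          have e1 (x) : ∀ l ∈ J, l ≠ i → ν l = some x := fun l hl hli => absurd (hJ l hl) hli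
          have e2 (x) : ∀ l ∈ J, l ≠ i → μ l = some x := fun l hl hli => absurd (hJ l hl) hli
          simp only [if_pos (e1 _), if_pos (e2 _)]
          have := h (.sum i t) (Nat.succ_le_succ ht)
          simp only [HomTerm.val] at this
          exact_mod_cast this)
    refine ⟨β, fun a => ?_⟩
    have hval (t : HomTerm ι) (ht : t.depth ≤ q) :
        t.val G (Function.update ν i (some a)) = t.val H (Function.update μ i (some (β a))) := by
      simpa using hβ ⟨∅, t, ht⟩ a
    have hpos (j) (hj : j ≠ i) : ν j = some a ↔ μ j = some (β a) := by
      have := hβ ⟨{j}, .one, Nat.zero_le _⟩ a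
      by_cases h1 : ν j = some a <;> by_cases h2 : μ j = some (β a) <;>
        simp_all [HomTerm.val]
    refine ih (fun j l => ?_) hval fun j l => ?_
    · by_cases hj : j = i <;> by_cases hl : l = i
      · simp [hj, hl, OptEq]
      · simp [hj, hl, OptEq, hpos]
      · simp [hj, hl, OptEq, hpos]
      · simpa [hj, hl] using heq j l
    · have := hval (.adj j l) (Nat.zero_le _)
      simp only [HomTerm.val] at this
      split_ifs at this with h1 h2 h2 <;> simp_all

/-! ### Terms as graphs -/

/-- The strict order and pebble condition for an edge with lower end `x` and upper end `y`, where
the free vertices `ι` carry their own pebble and are below all other vertices. -/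
def IsUpwardEdge {U : Type} (T : RootedForest U) (p : U → ι) : U ⊕ ι → U ⊕ ι → Prop
  | .inr _, .inr _ => True
  -- Once `i` is bound by a root with pebble `i`, this becomes the pebble condition for an edge from
  -- that root to `y`.
  | .inr i, .inl y => ∀ w, T.le w y → p w ≠ i
  | .inl x, .inl y => T.le x y ∧ ∀ w, T.lt x w → T.le w y → p x ≠ p w
  | .inl _, .inr _ => False

/-- A pebble forest cover of a graph with free vertices `ι`, given by its edge relation. -/
structure OpenCover (ι : Type) where
  U : Type
  fin : Finite U
  forest : RootedForest U
  pebble : U → ι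
  level : U → ℕ
  level_lt : ∀ x y, forest.lt x y → level x < level y
  rel : U ⊕ ι → U ⊕ ι → Prop
  upward : ∀ x y, rel x y → IsUpwardEdge forest pebble x y ∨ IsUpwardEdge forest pebble y x

attribute [instance] OpenCover.fin

/-- `h` maps the relation `R` to adjacency. -/
def MapsEdges {X : Type} (R : X → X → Prop) (G : SimpleGraph V) (h : X → Option V) : Prop :=
  ∀ x y, R x y → OptAdj G (h x) (h y)

theorem mapsEdges_map {X Y : Type} (R : X → X → Prop) (f : X → Y) (G : SimpleGraph V)
    (h : Y → Option V) : MapsEdges (Relation.Map R f f) G h ↔ MapsEdges R G (h ∘ f) := by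
  constructor
  · exact fun hh x y hxy => hh _ _ ⟨x, y, hxy, rfl, rfl⟩
  · rintro hh _ _ ⟨x, y, hxy, rfl, rfl⟩
    exact hh x y hxy

namespace OpenCover

/-- The number of homomorphisms from `P` to `G` that extend the position `ν`. -/
noncomputable def count (P : OpenCover ι) (G : SimpleGraph V) (ν : ι → Option V) : ℕ :=
  Nat.card {h : P.U → V // MapsEdges P.rel G (Sum.elim (fun u => some (h u)) ν)}

/-- The cover without vertices. -/
def ofRel (R : ι → ι → Prop) : OpenCover ι where
  U := Empty
  fin := inferInstance
  forest := ⟨fun _ _ => True, nofun, nofun, nofun, nofun⟩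
  pebble := nofun
  level := nofun
  level_lt := nofun
  rel x y := ∃ i j, x = .inr i ∧ y = .inr j ∧ R i j
  upward := by
    rintro _ _ ⟨i, j, rfl, rfl, -⟩
    exact Or.inl trivial

open Classical in
theorem count_ofRel (R : ι → ι → Prop) (G : SimpleGraph V) (ν : ι → Option V) :
    (ofRel R).count G ν = if ∀ i j, R i j → OptAdj G (ν i) (ν j) then 1 else 0 := by
  have key (h : Empty → V) : MapsEdges (ofRel R).rel G (Sum.elim (fun u => some (h u)) ν) ↔
      ∀ i j, R i j → OptAdj G (ν i) (ν j) := by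
    constructor
    · exact fun hh i j hij => hh (.inr i) (.inr j) ⟨i, j, rfl, rfl, hij⟩
    · rintro hh _ _ ⟨i, j, rfl, rfl, hij⟩
      exact hh i j hij
  rw [count]
  split_ifs with hR
  · rw [Nat.card_eq_one_iff_unique]
    exact ⟨⟨fun f g => Subtype.ext (funext nofun)⟩, ⟨⟨nofun, (key _).2 hR⟩⟩⟩
  · rw [Nat.card_eq_zero]
    exact Or.inl ⟨fun f => hR ((key f.1).1 f.2)⟩

/-- Disjoint union. -/
def disjSum (P Q : OpenCover ι) : OpenCover ι where
  U := P.U ⊕ Q.U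
  fin := inferInstance
  forest :=
    { le := Sum.LiftRel P.forest.le Q.forest.le
      le_refl := by rintro (u | u) <;> simp [P.forest.le_refl, Q.forest.le_refl]
      le_trans := by
        rintro _ _ _ (⟨h⟩ | ⟨h⟩) (⟨h'⟩ | ⟨h'⟩)
        · exact .inl (P.forest.le_trans _ _ _ h h')
        · exact .inr (Q.forest.le_trans _ _ _ h h')
      le_antisymm := by
        rintro _ _ (⟨h⟩ | ⟨h⟩) (⟨h'⟩ | ⟨h'⟩)
        · exact congrArg _ (P.forest.le_antisymm _ _ h h')
        · exact congrArg _ (Q.forest.le_antisymm _ _ h h')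
      comparable_below := by
        rintro _ _ _ (⟨h⟩ | ⟨h⟩) (⟨h'⟩ | ⟨h'⟩)
        · exact (P.forest.comparable_below _ _ _ h h').imp .inl .inl
        · exact (Q.forest.comparable_below _ _ _ h h').imp .inr .inr }
  pebble := Sum.elim P.pebble Q.pebble
  level := Sum.elim P.level Q.level
  level_lt := by
    rintro _ _ ⟨⟨h⟩ | ⟨h⟩, hne⟩
    · exact P.level_lt _ _ ⟨h, fun e => hne (congrArg _ e)⟩
    · exact Q.level_lt _ _ ⟨h, fun e => hne (congrArg _ e)⟩
  rel x y := Relation.Map P.rel (Sum.map .inl id) (Sum.map .inl id) x y ∨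
    Relation.Map Q.rel (Sum.map .inr id) (Sum.map .inr id) x y
  upward := by
    rintro _ _ (⟨x, y, h, rfl, rfl⟩ | ⟨x, y, h, rfl, rfl⟩)
    · refine (P.upward x y h).imp ?_ ?_ <;>
        rcases x with x | x <;> rcases y with y | y <;>
        simp +contextual [IsUpwardEdge, RootedForest.lt]
    · refine (Q.upward x y h).imp ?_ ?_ <;>
        rcases x with x | x <;> rcases y with y | y <;>
        simp +contextual [IsUpwardEdge, RootedForest.lt]

theorem count_disjSum (P Q : OpenCover ι) (G : SimpleGraph V) (ν : ι → Option V) :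
    (P.disjSum Q).count G ν = P.count G ν * Q.count G ν := by
  rw [count, count, count, ← Nat.card_prod]
  refine Nat.card_congr (((Equiv.sumArrowEquivProdArrow P.U Q.U V).subtypeEquiv fun h => ?_).trans
    Equiv.subtypeProdEquivProd)
  have key : MapsEdges (P.disjSum Q).rel G (Sum.elim (fun u => some (h u)) ν) ↔
      MapsEdges (Relation.Map P.rel (Sum.map .inl id) (Sum.map .inl id)) G
        (Sum.elim (fun u => some (h u)) ν) ∧
      MapsEdges (Relation.Map Q.rel (Sum.map .inr id) (Sum.map .inr id)) G
        (Sum.elim (fun u => some (h u)) ν) := by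
    simp only [MapsEdges, disjSum, or_imp, forall_and]
  rw [key, mapsEdges_map, mapsEdges_map, Sum.elim_comp_map, Sum.elim_comp_map]
  rfl

/-- Binding of the free vertex `i` by a new root. -/
def bind [DecidableEq ι] (i : ι) (P : OpenCover ι) : OpenCover ι where
  U := Option P.U
  fin := inferInstance
  forest :=
    -- With this order `none` is below every vertex.
    { le := fun x y => ∀ u ∈ x, ∃ v ∈ y, P.forest.le u v
      le_refl := fun x u hu => ⟨u, hu, P.forest.le_refl u⟩
      le_trans := fun x y z hxy hyz u hu => by
        obtain ⟨v, hv, huv⟩ := hxy u hu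
        obtain ⟨w, hw, hvw⟩ := hyz v hv
        exact ⟨w, hw, P.forest.le_trans _ _ _ huv hvw⟩
      le_antisymm := by
        rintro (_ | x) (_ | y) h h'
        · rfl
        · simpa using h' y rfl
        · simpa using h x rfl
        · exact congrArg _ (P.forest.le_antisymm x y (by simpa using h) (by simpa using h'))
      comparable_below := by
        rintro (_ | x) (_ | y) (_ | z) h h' <;> simp_all
        exact P.forest.comparable_below x y z h h' }
  pebble x := x.elim i P.pebble
  level x := x.elim 0 fun u => P.level u + 1
  level_lt := by
    rintro (_ | x) (_ | y) ⟨h, hne⟩ <;> simp_all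
    exact P.level_lt x y ⟨h, hne⟩
  -- The new root takes over all edges at `i`, which stays as an isolated free vertex and may be
  -- bound again.
  rel := Relation.Map P.rel
    (Sum.elim (fun u => .inl (some u)) fun j => if j = i then .inl none else .inr j)
    (Sum.elim (fun u => .inl (some u)) fun j => if j = i then .inl none else .inr j)
  upward := by
    rintro _ _ ⟨x, y, h, rfl, rfl⟩
    have hup := P.upward x y h
    clear h
    wlog hup' : IsUpwardEdge P.forest P.pebble x y generalizing x y
    · exact (this y x hup.symm (hup.resolve_left hup')).symm
    clear hup
    rename _ => hup
    rcases x with x | j <;> rcases y with y | l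
    · simp_all [IsUpwardEdge, RootedForest.lt, Option.forall]
    · exact hup.elim
    · by_cases hj : j = i
      · subst hj
        simpa [IsUpwardEdge, RootedForest.lt, Option.forall, eq_comm] using hup
      · simpa [IsUpwardEdge, Option.forall, hj, Ne.symm hj] using hup
    · by_cases hj : j = i <;> by_cases hl : l = i <;>
        simp_all [IsUpwardEdge, RootedForest.lt, Option.forall, eq_comm (a := i)]

theorem count_bind [DecidableEq ι] [Fintype V] (i : ι) (P : OpenCover ι) (G : SimpleGraph V) (ν : ι → Option V) :
    (P.bind i).count G ν = ∑ a : V, P.count G (Function.update ν i (some a)) := by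
  simp only [count]
  rw [← Nat.card_sigma]
  have key (h : Option P.U → V) : MapsEdges (P.bind i).rel G (Sum.elim (fun u => some (h u)) ν) ↔
      MapsEdges P.rel G (Sum.elim (fun u => some (h (some u)))
        (Function.update ν i (some (h none)))) := by
    refine (mapsEdges_map _ _ _ _).trans ?_
    refine iff_of_eq (congrArg _ (funext fun x => ?_))
    rcases x with x | j
    · rfl
    · by_cases hj : j = i
      · subst hj
        rw [Sum.elim_inr, Function.update_self]
        exact congrArg (Sum.elim (fun u => some (h u)) ν) (if_pos rfl)
      · rw [Sum.elim_inr, Function.update_of_ne hj]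
        exact congrArg (Sum.elim (fun u => some (h u)) ν) (if_neg hj)
  refine Nat.card_congr
    { toFun := fun h => ⟨h.1 none, fun u => h.1 (some u), (key h.1).1 h.2⟩
      invFun := fun h => ⟨fun x => x.elim h.1 h.2.1, (key _).2 h.2.2⟩
      left_inv := fun h => Subtype.ext (funext fun x => by cases x <;> rfl)
      right_inv := fun h => rfl }

end OpenCover

/-- The open cover described by a term. -/
def HomTerm.toCover [DecidableEq ι] : HomTerm ι → OpenCover ι
  | one => .ofRel fun _ _ => False
  | adj i j => .ofRel fun a b => a = i ∧ b = j
  | mul s t => s.toCover.disjSum t.toCover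
  | sum i t => t.toCover.bind i

theorem HomTerm.count_toCover [DecidableEq ι] [Fintype V] (G : SimpleGraph V) (t : HomTerm ι)
    (ν : ι → Option V) : t.toCover.count G ν = t.val G ν := by
  induction t generalizing ν with
  | one => simp [toCover, val, OpenCover.count_ofRel]
  | adj i j =>
    classical
    rw [toCover, OpenCover.count_ofRel, val]
    exact if_congr ⟨fun h => h i j ⟨rfl, rfl⟩, by rintro h _ _ ⟨rfl, rfl⟩; exact h⟩ rfl rfl
  | mul s t ihs iht => rw [toCover, OpenCover.count_disjSum, ihs, iht, val]
  | sum i t ih => simp only [toCover, OpenCover.count_bind, ih, val]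

theorem HomTerm.level_toCover_lt [DecidableEq ι] (t : HomTerm ι) (x : t.toCover.U) :
    t.toCover.level x < t.depth := by
  induction t with
  | one => exact x.elim
  | adj i j => exact x.elim
  | mul s t ihs iht =>
    rcases x with x | x
    · exact (ihs x).trans_le (le_max_left _ _)
    · exact (iht x).trans_le (le_max_right _ _)
  | sum i t ih =>
    rcases x with _ | x
    · exact Nat.succ_pos _
    · exact Nat.succ_lt_succ (ih x)

/-! ### Closed covers and homomorphism counts -/

namespace OpenCover

/-- The edges of `P` avoid the free vertices and are no loops. -/
def IsClosed (P : OpenCover ι) : Prop :=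
  ∀ x y, P.rel x y → ∃ u v, x = .inl u ∧ y = .inl v ∧ u ≠ v

/-- An unplaced free vertex has no image and a loop has no target in a simple graph, so such terms
impose nothing on the graphs compared. -/
theorem count_of_not_isClosed {P : OpenCover ι} (hP : ¬ P.IsClosed) (G : SimpleGraph V) :
    P.count G (fun _ => none) = 0 := by
  rw [count, Nat.card_eq_zero]
  refine Or.inl ⟨fun ⟨h, hh⟩ => hP fun x y hxy => ?_⟩
  obtain ⟨a, b, hx, hy, hab⟩ := hh x y hxy
  rcases x with x | x <;> rcases y with y | y <;>
    simp only [Sum.elim_inl, Sum.elim_inr, reduceCtorEq, Option.some.injEq] at hx hy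
  refine ⟨x, y, rfl, rfl, ?_⟩
  rintro rfl
  exact hab.ne (hx.symm.trans hy)

/-- The graph covered by `P`. -/
def graph (P : OpenCover ι) : SimpleGraph P.U :=
  SimpleGraph.fromRel fun x y => P.rel (.inl x) (.inl y)

theorem count_of_isClosed {P : OpenCover ι} (hP : P.IsClosed) (G : SimpleGraph V) :
    P.count G (fun _ => none) = homCount P.graph G := by
  refine Nat.card_congr
    { toFun := fun h => ⟨h.1, fun {x y} hxy => ?_⟩
      invFun := fun h => ⟨h, fun x y hxy => ?_⟩
      left_inv := fun h => rfl
      right_inv := fun h => rfl }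
  · rcases hxy.2 with h' | h'
    · exact optAdj_some.1 (h.2 _ _ h')
    · exact (optAdj_some.1 (h.2 _ _ h')).symm
  · obtain ⟨u, v, rfl, rfl, huv⟩ := hP x y hxy
    exact optAdj_some.2 (h.map_adj ⟨huv, Or.inl hxy⟩)

theorem isUpwardEdge_of_adj (P : OpenCover ι) {x y : P.U} (h : P.graph.Adj x y) :
    IsUpwardEdge P.forest P.pebble (.inl x) (.inl y) ∨
      IsUpwardEdge P.forest P.pebble (.inl y) (.inl x) :=
  h.2.elim (P.upward _ _) fun h => (P.upward _ _ h).symm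

/-- The cover of the underlying graph. -/
def toPebbleForestCover {k : ℕ} (f : ι ↪ Fin k) (P : OpenCover ι) :
    PebbleForestCover k P.graph where
  forest := P.forest
  pebble x := f (P.pebble x)
  adj_comparable _ _ h := (P.isUpwardEdge_of_adj h).imp And.left And.left
  pebble_ne x y h hxy w hxw hwy := by
    refine f.injective.ne ?_
    rcases P.isUpwardEdge_of_adj h with h | h
    · exact h.2 w hxw hwy
    · exact absurd (P.forest.le_antisymm _ _ hxy.1 h.1) hxy.2

theorem height_le {P : OpenCover ι} {q : ℕ} (hq : ∀ x, P.level x < q) :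
    P.forest.height ≤ q := by
  refine iSup₂_le fun s hs => ?_
  rw [Nat.cast_le, ← Finset.card_range q]
  refine Finset.card_le_card_of_injOn P.level (fun x _ => by simpa using hq x) ?_
  intro x hx y hy hxy
  by_contra hne
  rcases hs hx hy hne with h | h
  · exact (P.level_lt x y ⟨h, hne⟩).ne hxy
  · exact (P.level_lt y x ⟨h, Ne.symm hne⟩).ne hxy.symm

end OpenCover

theorem HomIndistinguishable.val_eq [DecidableEq ι] [Fintype V] [Fintype W] {k q : ℕ}
    {G : SimpleGraph V} {H : SimpleGraph W}
    (h : HomIndistinguishable (pebbleForestClass k q) G H) (f : ι ↪ Fin k) {t : HomTerm ι}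
    (ht : t.depth ≤ q) : t.val G (fun _ => none) = t.val H (fun _ => none) := by
  rw [← t.count_toCover, ← t.count_toCover]
  by_cases hP : t.toCover.IsClosed
  · rw [OpenCover.count_of_isClosed hP, OpenCover.count_of_isClosed hP]
    exact h _ _ ⟨t.toCover.toPebbleForestCover f,
      OpenCover.height_le fun x => (t.level_toCover_lt x).trans_le ht⟩
  · rw [OpenCover.count_of_not_isClosed hP, OpenCover.count_of_not_isClosed hP]

end CountingLogic

/-! ### The characterization -/

theorem mainTheorem4 (k q : ℕ) (hk : 1 ≤ k) (hq : 1 ≤ q)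
    {V : Type u} {W : Type v} [Finite V] [Finite W]
    (G : SimpleGraph V) (H : SimpleGraph W) :
    CountingLogic.Equivalent (CountingLogic.fragment k q) G H ↔
      CountingLogic.HomIndistinguishable (CountingLogic.pebbleForestClass k q) G H := by
  open CountingLogic in
  cases nonempty_fintype V
  cases nonempty_fintype W
  constructor
  · rintro h U _ F ⟨C, hC⟩
    refine PebbleEquiv.homCount_eq C hC (pebbleEquiv_of_holds_iff Fin.val_injective
      (ν := fun _ => none) (μ := fun _ => none) (by simp) fun φ hφ hqr hfree => ?_)
    refine h φ ⟨?_, hqr⟩ (Finset.eq_empty_of_forall_notMem fun i hi => hfree i hi rfl)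
    rw [Fin.range_val] at hφ
    have hsub : φ.vars ⊆ Finset.range k := fun i hi => by simpa using hφ hi
    simpa [varFragment] using Finset.card_le_card hsub
  · intro h φ hφ _
    -- The game is played with the variables of `φ` themselves as pebbles; only an injection into
    -- the `k` labels is needed.
    have f : {i // i ∈ φ.vars} ↪ Fin k :=
      (Function.Embedding.nonempty_of_card_le (by simpa using show φ.vars.card ≤ k from hφ.1)).some
    exact PebbleEquiv.holds_iff Subtype.val_injective φ (by simp) hφ.2
      (pebbleEquiv_of_val_eq (fun i j => by simp [OptEq]) fun t ht => h.val_eq f ht)
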